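/- Let $[n]=\{1,\dots,n\}$ and let $[n]^{(3)}$ denote the set of all $3$-element subsets of $[n]$, also viewed as the complete $3$-graph on $[n]$. A $3$-graph $G$ on $[n]$ is given by an edge set $E(G)\subseteq [n]^{(3)}$, and its Lagrangian is $$\lambda(G)=\max\Big\{\sum_{\{a,b,c\}\in E(G)}x_ax_bx_c \;:\; x_1,\dots,x_n\ge 0,\ \sum_{v=1}^n x_v=1\Big\}.$$ $G$ is left-compressed if, whenever $\{b_1<b_2<b_3\}\in E(G)$ and $1\le a_1<a_2<a_3$ are integers with $a_p\le b_p$ for $p=1,2,3$, also $\{a_1,a_2,a_3\}\in E(G)$. In the colex ordering, $A<B$ for distinct finite sets $A,B$ of positive integers if $\max(A\,\triangle\, B)\in B$. Let $i\ge j\ge 1$ and $l$ be positive integers, and let $G$ be a left-compressed $3$-graph on $[l]$ with exactly $\binom{l-1}{3}+\binom{l-2}{2}$ edges. Suppose that the first $j+1$ triples, in the colex ordering, of the complement $G^c=[l]^{(3)}\setminus E(G)$ are the $j$ triples $\{a,\,l-2,\,l-1\}$ with $l-2-j\le a\le l-3$, followed by the triple $\{l-2-i,\,l-2,\,l\}$.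 Then $$\lambda(G)<\lambda\big([l-1]^{(3)}\big).$$ -/

import Mathlib

/-- An `r`-uniform hypergraph (an `r`-graph) on the vertex set `[n] = {1, …, n}`. -/
structure RGraph (r n : ℕ) where
  /-- The set of edges. -/
  edges : Finset (Finset ℕ)
  edges_subset : edges ⊆ (Finset.Icc 1 n).powersetCard r

namespace RGraph

/-- The complete `r`-graph `[n]^(r)`, whose edges are all `r`-subsets of `{1, …, n}`. -/
def complete (r n : ℕ) : RGraph r n where
  edges := (Finset.Icc 1 n).powersetCard r
  edges_subset := Finset.Subset.refl _

/-- The complement `Gᶜ = [n]^(r) \ E(G)`. -/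
def compl {r n : ℕ} (G : RGraph r n) : RGraph r n where
  edges := (Finset.Icc 1 n).powersetCard r \ G.edges
  edges_subset := Finset.sdiff_subset

/-- `G` is left-compressed: if `b₁ < ⋯ < b_r` form an edge and `a₁ < ⋯ < a_r` are vertices with
`a_p ≤ b_p` for every `p`, then `a₁, …, a_r` form an edge. -/
def LeftCompressed {r n : ℕ} (G : RGraph r n) : Prop :=
  ∀ a b : Fin r → ℕ, StrictMono a → StrictMono b → (∀ p, 1 ≤ a p) → (∀ p, a p ≤ b p) →
    Finset.univ.image b ∈ G.edges → Finset.univ.image a ∈ G.edges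

/-- The set `S` of legal weightings: nonnegative weights on `{1, …, n}` with sum `1`. A vector
indexed by `{1, …, n}` is represented by its extension by zero to `ℕ`. -/
def weightings (n : ℕ) : Set (ℕ → ℝ) :=
  {x | (∀ v, 0 ≤ x v) ∧ (∀ v, v ∉ Finset.Icc 1 n → x v = 0) ∧ ∑ v ∈ Finset.Icc 1 n, x v = 1}

/-- `λ(G, x)`, the sum over the edges of the product of the weights of their vertices. -/
def weight {r n : ℕ} (G : RGraph r n) (x : ℕ → ℝ) : ℝ :=
  ∑ e ∈ G.edges, ∏ v ∈ e, x v

/-- The Lagrangian `λ(G)`, the maximum of `λ(G, x)` over all legal weightings `x`; that the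
supremum is a maximum is `isGreatest_lagrangian`. -/
noncomputable def lagrangian {r n : ℕ} (G : RGraph r n) : ℝ :=
  sSup (G.weight '' weightings n)

theorem isCompact_weightings (n : ℕ) : IsCompact (weightings n) := by
  refine IsCompact.of_isClosed_subset
    (isCompact_univ_pi (s := fun _ : ℕ => Set.Icc (0 : ℝ) 1) fun _ => isCompact_Icc) ?_ ?_
  · simp only [weightings, Set.ofPred_and, Set.ofPred_forall]
    refine (isClosed_iInter fun v => isClosed_le continuous_const (continuous_apply v)).inter
      ((isClosed_iInter fun v => isClosed_iInter fun _ =>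
        isClosed_eq (continuous_apply v) continuous_const).inter
        (isClosed_eq (by fun_prop) continuous_const))
  · rintro x ⟨h0, h1, h2⟩ v -
    refine ⟨h0 v, ?_⟩
    by_cases hv : v ∈ Finset.Icc 1 n
    · exact h2 ▸ Finset.single_le_sum (fun w _ => h0 w) hv
    · simp [h1 v hv]

theorem weightings_nonempty {n : ℕ} (hn : 1 ≤ n) : (weightings n).Nonempty := by
  refine ⟨Pi.single 1 1, fun v => ?_, fun v hv => ?_, ?_⟩
  · by_cases h : v = 1
    · subst h; simp
    · simp [h]
  · have h : v ≠ 1 := by rintro rfl; simp at hv; omega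
    simp [h]
  · rw [Finset.sum_pi_single']
    simp [hn]

/-- The Lagrangian of an `r`-graph with at least one vertex is attained. -/
theorem isGreatest_lagrangian {r n : ℕ} (G : RGraph r n) (hn : 1 ≤ n) :
    IsGreatest (G.weight '' weightings n) G.lagrangian := by
  refine ((isCompact_weightings n).image ?_).isGreatest_sSup ((weightings_nonempty hn).image _)
  unfold weight
  fun_prop

end RGraph

/-- The members of `A` are the first `k` members of the family `F` in the colex ordering, where
`s < t` in colex means `max (s ∆ t) ∈ t`. -/
def IsFirstColex (k : ℕ) (F A : Finset (Finset ℕ)) : Prop :=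
  A ⊆ F ∧ A.card = k ∧ ∀ s ∈ A, ∀ t ∈ F, t ∉ A → toColex s < toColex t

/-! Write l = n + 3. Compression and the colex hypothesis force the nonedges to be {n+1, n+2, n+3}
and the triples {a, n+1, n+2}, {a, n+1, n+3}, {a, n+2, n+3} with a in D, I, K respectively, where D
⊆ I ⊆ K ⊆ [n]. The edge count gives |D| + |I| + |K| = n.

Suppose λ(G) ≥ λ([l-1]^(3)) and take a maximizer with weights w on [n] and p ≥ q ≥ r on the last
three vertices, all w at least p. Compare it with the weighting of [n+2] that gives each vertex of
[n] the mean m of w and splits p + q + r equally between two vertices. For constant w the new value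
exceeds the old by exactly m (n(p-q-r)²/4 + j q(p-r) + i r(p-q)), because the nonedges number
exactly n + 1.

A nonconstant w may avoid the nonedges by putting less weight on D, I, K. But its squared deviation
V costs at least κV/2 in the symmetric sum, with κ > 0 because no w exceeds 1/3
(`maximizer_le_third`). Young's inequality bounds what is saved by κV/2 plus a multiple of the
squared deviation of the nonedge coefficients, and `sq_sum_deviation_lt` bounds that multiple by the
gain above. This is `esymm_sub_nonedge_lt`. The cases n = 3 and p + q + r = 0 are settled directly.
-/

/-! ### Elementary symmetric sums through power sums -/

theorem Finset.sum_powersetCard_succ_insert_prod {x : ℕ → ℝ} {a : ℕ} {s : Finset ℕ} (h : a ∉ s)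
    (k : ℕ) :
    ∑ e ∈ (insert a s).powersetCard (k + 1), ∏ v ∈ e, x v =
      ∑ e ∈ s.powersetCard (k + 1), ∏ v ∈ e, x v + x a * ∑ e ∈ s.powersetCard k, ∏ v ∈ e, x v := by
  have hmem : ∀ e ∈ s.powersetCard k, a ∉ e := fun e he hae =>
    h ((Finset.mem_powersetCard.1 he).1 hae)
  rw [Finset.powersetCard_succ_insert h, Finset.sum_union, Finset.sum_image, Finset.mul_sum]
  · congr 1
    exact Finset.sum_congr rfl fun e he => Finset.prod_insert (hmem e he)
  · intro e he f hf hef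
    rw [← Finset.erase_insert (hmem e he), ← Finset.erase_insert (hmem f hf), hef]
  · rw [Finset.disjoint_left]
    intro e he hef
    obtain ⟨f, -, rfl⟩ := Finset.mem_image.1 hef
    exact h ((Finset.mem_powersetCard.1 he).1 (Finset.mem_insert_self a f))

theorem Finset.sum_powersetCard_one_prod (x : ℕ → ℝ) (s : Finset ℕ) :
    ∑ e ∈ s.powersetCard 1, ∏ v ∈ e, x v = ∑ v ∈ s, x v := by
  induction s using Finset.induction_on with
  | empty => rw [Finset.powersetCard_eq_empty.2 (by simp)]; simp
  | insert a s h ih =>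
    rw [Finset.sum_powersetCard_succ_insert_prod h, ih, Finset.sum_insert h]
    simp [add_comm]

theorem Finset.sum_powersetCard_two_prod (x : ℕ → ℝ) (s : Finset ℕ) :
    ∑ e ∈ s.powersetCard 2, ∏ v ∈ e, x v = ((∑ v ∈ s, x v) ^ 2 - ∑ v ∈ s, x v ^ 2) / 2 := by
  induction s using Finset.induction_on with
  | empty => rw [Finset.powersetCard_eq_empty.2 (by simp)]; simp
  | insert a s h ih =>
    rw [Finset.sum_powersetCard_succ_insert_prod h, ih, Finset.sum_powersetCard_one_prod,
      Finset.sum_insert h, Finset.sum_insert h]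
    ring

/-- The third elementary symmetric sum in terms of power sums. -/
theorem Finset.sum_powersetCard_three_prod (x : ℕ → ℝ) (s : Finset ℕ) :
    ∑ e ∈ s.powersetCard 3, ∏ v ∈ e, x v =
      ((∑ v ∈ s, x v) ^ 3 - 3 * (∑ v ∈ s, x v) * (∑ v ∈ s, x v ^ 2) + 2 * ∑ v ∈ s, x v ^ 3) / 6 := by
  induction s using Finset.induction_on with
  | empty => rw [Finset.powersetCard_eq_empty.2 (by simp)]; simp
  | insert a s h ih =>
    rw [Finset.sum_powersetCard_succ_insert_prod h, ih, Finset.sum_powersetCard_two_prod,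
      Finset.sum_insert h, Finset.sum_insert h, Finset.sum_insert h]
    ring

/-! ### The shape of the complement -/

namespace RGraph

/-- The weight of the triples that meet `{n + 1, n + 2, n + 3}` in at least two vertices, where the
pairs of these three vertices are completed by the vertices in `D`, `I` and `K` respectively. -/
def nonedgeWeight (n : ℕ) (D I K : Finset ℕ) (x : ℕ → ℝ) : ℝ :=
  x (n + 1) * x (n + 2) * x (n + 3) + x (n + 1) * x (n + 2) * ∑ v ∈ D, x v +
    x (n + 1) * x (n + 3) * ∑ v ∈ I, x v + x (n + 2) * x (n + 3) * ∑ v ∈ K, x v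

theorem weight_add_weight_compl {r n : ℕ} (G : RGraph r n) (x : ℕ → ℝ) :
    G.weight x + G.compl.weight x = (complete r n).weight x := by
  rw [add_comm]
  exact Finset.sum_sdiff G.edges_subset

theorem LeftCompressed.triple_mem_compl {n : ℕ} {G : RGraph 3 n} (hG : G.LeftCompressed)
    {a b c a' b' c' : ℕ} (hab : a < b) (hbc : b < c) (hab' : a' < b') (hbc' : b' < c')
    (ha : a ≤ a') (hb : b ≤ b') (hc : c ≤ c') (hc' : c' ≤ n)
    (h : {a, b, c} ∈ G.compl.edges) : {a', b', c'} ∈ G.compl.edges := by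
  obtain ⟨h1, h2⟩ := Finset.mem_sdiff.1 h
  have ha1 : 1 ≤ a :=
    (Finset.mem_Icc.1 ((Finset.mem_powersetCard.1 h1).1 (Finset.mem_insert_self _ _))).1
  refine Finset.mem_sdiff.2 ⟨Finset.mem_powersetCard.2 ⟨?_, ?_⟩, fun h3 => h2 ?_⟩
  · intro v hv
    simp only [Finset.mem_insert, Finset.mem_singleton] at hv
    rw [Finset.mem_Icc]
    omega
  · rw [Finset.card_eq_three]
    exact ⟨a', b', c', by omega, by omega, by omega, rfl⟩
  · have key := hG ![a, b, c] ![a', b', c'] (by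
        rw [Fin.strictMono_iff_lt_succ]; intro p; fin_cases p <;> simpa) (by
        rw [Fin.strictMono_iff_lt_succ]; intro p; fin_cases p <;> simpa)
        (by intro p; fin_cases p <;> simp <;> omega) (by intro p; fin_cases p <;> simpa)
    have e : ∀ u v w : ℕ, Finset.univ.image ![u, v, w] = {u, v, w} := by
      intro u v w
      ext z
      simp [Fin.exists_fin_succ, eq_comm]
    rw [e, e] at key
    exact key h3

theorem exists_eq_triple {t : Finset ℕ} (ht : t.card = 3) {b c : ℕ} (hb : b ∈ t) (hc : c ∈ t)
    (hbc : b ≠ c) : ∃ a, a ≠ b ∧ a ≠ c ∧ t = {a, b, c} := by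
  have h1 : ((t.erase c).erase b).card = 1 := by
    rw [Finset.card_erase_of_mem (Finset.mem_erase.2 ⟨hbc, hb⟩), Finset.card_erase_of_mem hc, ht]
  obtain ⟨a, ha⟩ := Finset.card_eq_one.1 h1
  have ha' : a ∈ (t.erase c).erase b := ha ▸ Finset.mem_singleton_self a
  simp only [Finset.mem_erase] at ha'
  refine ⟨a, ha'.1, ha'.2.1, ?_⟩
  rw [← Finset.insert_erase hc, ← Finset.insert_erase (Finset.mem_erase.2 ⟨hbc, hb⟩), ha]
  ext z
  simp only [Finset.mem_insert, Finset.mem_singleton]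
  tauto

theorem triple_injOn (b c : ℕ) (s : Finset ℕ) (hb : b ∉ s) (hc : c ∉ s) :
    Set.InjOn (fun a => ({a, b, c} : Finset ℕ)) s := by
  intro a ha a' ha' h
  have h1 : a ∈ ({a', b, c} : Finset ℕ) := by
    rw [← show ({a, b, c} : Finset ℕ) = {a', b, c} from h]
    exact Finset.mem_insert_self _ _
  simp only [Finset.mem_insert, Finset.mem_singleton] at h1
  rcases h1 with h1 | h1 | h1
  · exact h1
  · exact absurd (h1 ▸ ha) hb
  · exact absurd (h1 ▸ ha) hc

/-- The hypotheses on the complement determine it up to the set `K` of vertices completing the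
pair of the last two vertices. -/
theorem exists_compl_edges_eq {n i j : ℕ} (hj : 1 ≤ j) (hij : j ≤ i) {G : RGraph 3 (n + 3)}
    (hG : G.LeftCompressed)
    (hfirst : IsFirstColex (j + 1) G.compl.edges
      ((Finset.Icc (n + 1 - j) n).image (fun a => {a, n + 1, n + 2}) ∪
        {{n + 1 - i, n + 1, n + 3}})) :
    i ≤ n ∧ ∃ K ⊆ Finset.Icc 1 n, Finset.Icc (n + 1 - i) n ⊆ K ∧ G.compl.edges =
      (Finset.Icc (n + 1 - j) n).image (fun a => {a, n + 1, n + 2}) ∪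
      (Finset.Icc (n + 1 - i) n).image (fun a => {a, n + 1, n + 3}) ∪
      (insert (n + 1) K).image (fun a => {a, n + 2, n + 3}) := by
  obtain ⟨hsub, -, hlt⟩ := hfirst
  have hs : ({n + 1 - i, n + 1, n + 3} : Finset ℕ) ∈ G.compl.edges :=
    hsub (Finset.mem_union_right _ (Finset.mem_singleton_self _))
  -- Vertices are at least 1, so the truncated difference n + 1 - i is not 0.
  have hin : i ≤ n := by
    have h := (Finset.mem_powersetCard.1 (G.compl.edges_subset hs)).1
      (Finset.mem_insert_self _ _)
    rw [Finset.mem_Icc] at h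
    omega
  refine ⟨hin, (Finset.Icc 1 n).filter (fun a => {a, n + 2, n + 3} ∈ G.compl.edges),
    Finset.filter_subset _ _, ?_, ?_⟩
  · intro a ha
    rw [Finset.mem_Icc] at ha
    rw [Finset.mem_filter, Finset.mem_Icc]
    exact ⟨by omega, hG.triple_mem_compl (by omega) (by omega) (by omega) (by omega) ha.1
      (by omega) le_rfl le_rfl hs⟩
  · apply Finset.Subset.antisymm
    · intro t ht
      by_cases htA : t ∈ (Finset.Icc (n + 1 - j) n).image
          (fun a => ({a, n + 1, n + 2} : Finset ℕ)) ∪ {{n + 1 - i, n + 1, n + 3}}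
      · rcases Finset.mem_union.1 htA with h | h
        · exact Finset.mem_union_left _ (Finset.mem_union_left _ h)
        · rw [Finset.mem_singleton] at h
          exact Finset.mem_union_left _ (Finset.mem_union_right _ (Finset.mem_image.2
            ⟨n + 1 - i, Finset.mem_Icc.2 ⟨le_rfl, by omega⟩, h.symm⟩))
      -- Any further nonedge t comes after {n+1-i, n+1, n+3}: each element of that triple missing
      -- from t is dominated by an element of t outside it. This puts n + 3 in t, then n + 2 or n +
      -- 1.
      · have hst := (Finset.Colex.toColex_lt_toColex.1
          (hlt _ (Finset.mem_union_right _ (Finset.mem_singleton_self _)) t ht htA)).2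
        obtain ⟨htI, htc⟩ := Finset.mem_powersetCard.1 (G.compl.edges_subset ht)
        have hbd : ∀ v ∈ t, 1 ≤ v ∧ v ≤ n + 3 := fun v hv => Finset.mem_Icc.1 (htI hv)
        simp only [Finset.mem_insert, Finset.mem_singleton, not_or] at hst
        have h3 : n + 3 ∈ t := by
          by_contra h
          obtain ⟨b, hb, hb', hle⟩ := hst (Or.inr (Or.inr rfl)) h
          have := hbd b hb
          omega
        by_cases h2 : n + 2 ∈ t
        · obtain ⟨a, ha2, ha3, rfl⟩ := exists_eq_triple htc h2 h3 (by omega)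
          have := hbd a (Finset.mem_insert_self _ _)
          refine Finset.mem_union_right _ (Finset.mem_image.2 ⟨a, ?_, rfl⟩)
          rw [Finset.mem_insert, Finset.mem_filter, Finset.mem_Icc]
          by_cases ha1 : a = n + 1
          · exact Or.inl ha1
          · exact Or.inr ⟨by omega, ht⟩
        · have h1 : n + 1 ∈ t := by
            by_contra h
            obtain ⟨b, hb, hb', hle⟩ := hst (Or.inr (Or.inl rfl)) h
            have := hbd b hb
            have : b ≠ n + 2 := fun h => h2 (h ▸ hb)
            omega
          obtain ⟨a, ha1, ha3, rfl⟩ := exists_eq_triple htc h1 h3 (by omega)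
          have := hbd a (Finset.mem_insert_self _ _)
          have ha2 : a ≠ n + 2 := fun h => h2 (h ▸ Finset.mem_insert_self _ _)
          refine Finset.mem_union_left _ (Finset.mem_union_right _
            (Finset.mem_image.2 ⟨a, ?_, rfl⟩))
          rw [Finset.mem_Icc]
          refine ⟨?_, by omega⟩
          by_contra hlt'
          obtain ⟨b, hb, hb', hle⟩ := hst (Or.inl rfl) (by
            simp only [Finset.mem_insert, Finset.mem_singleton]
            omega)
          simp only [Finset.mem_insert, Finset.mem_singleton] at hb
          omega
    -- Conversely, the complement of a compressed graph is closed upwards, so {n+1-i, n+1, n+3}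
    -- generates the required triples.
    · intro t ht
      simp only [Finset.mem_union, Finset.mem_image] at ht
      rcases ht with (⟨a, ha, rfl⟩ | ⟨a, ha, rfl⟩) | ⟨a, ha, rfl⟩
      · exact hsub (Finset.mem_union_left _ (Finset.mem_image_of_mem _ ha))
      · rw [Finset.mem_Icc] at ha
        exact hG.triple_mem_compl (by omega) (by omega) (by omega) (by omega) ha.1
          le_rfl le_rfl le_rfl hs
      · rcases Finset.mem_insert.1 ha with rfl | ha
        · exact hG.triple_mem_compl (by omega) (by omega) (by omega) (by omega) (by omega)
            (by omega) le_rfl le_rfl hs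
        · exact (Finset.mem_filter.1 ha).2

theorem exists_sum_compl_edges {n i j : ℕ} (hj : 1 ≤ j) (hij : j ≤ i) {G : RGraph 3 (n + 3)}
    (hG : G.LeftCompressed)
    (hfirst : IsFirstColex (j + 1) G.compl.edges
      ((Finset.Icc (n + 1 - j) n).image (fun a => {a, n + 1, n + 2}) ∪
        {{n + 1 - i, n + 1, n + 3}})) :
    i ≤ n ∧ ∃ K ⊆ Finset.Icc 1 n, Finset.Icc (n + 1 - i) n ⊆ K ∧ ∀ F : Finset ℕ → ℝ,
      ∑ e ∈ G.compl.edges, F e = ∑ a ∈ Finset.Icc (n + 1 - j) n, F {a, n + 1, n + 2} +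
        ∑ a ∈ Finset.Icc (n + 1 - i) n, F {a, n + 1, n + 3} +
        (F {n + 1, n + 2, n + 3} + ∑ a ∈ K, F {a, n + 2, n + 3}) := by
  obtain ⟨hin, K, hK, hIK, h⟩ := exists_compl_edges_eq hj hij hG hfirst
  refine ⟨hin, K, hK, hIK, fun F => ?_⟩
  have hK' : ∀ v ∈ K, 1 ≤ v ∧ v ≤ n := fun v hv => Finset.mem_Icc.1 (hK hv)
  have hout : ∀ v, n < v → v ∉ K := fun v hv hvK => by have := hK' v hvK; omega
  have hmem : ∀ {s t : Finset ℕ} {v : ℕ}, s = t → v ∈ t → v ∈ s := fun h hv => h ▸ hv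
  rw [h, Finset.sum_union, Finset.sum_union, Finset.sum_image, Finset.sum_image, Finset.sum_image,
    Finset.sum_insert (hout _ (by omega))]
  · refine triple_injOn _ _ _ ?_ ?_ <;> rw [Finset.mem_insert, not_or] <;>
      exact ⟨by omega, hout _ (by omega)⟩
  · refine triple_injOn _ _ _ ?_ ?_ <;> rw [Finset.mem_Icc] <;> omega
  · refine triple_injOn _ _ _ ?_ ?_ <;> rw [Finset.mem_Icc] <;> omega
  · rw [Finset.disjoint_left]
    intro t ht ht'
    obtain ⟨a, ha, rfl⟩ := Finset.mem_image.1 ht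
    obtain ⟨b, hb, hbe⟩ := Finset.mem_image.1 ht'
    have h3 := hmem hbe.symm (v := n + 3) (by simp)
    simp only [Finset.mem_insert, Finset.mem_singleton, Finset.mem_Icc] at h3 ha
    omega
  · rw [Finset.disjoint_left]
    intro t ht ht'
    obtain ⟨b, hb, rfl⟩ := Finset.mem_image.1 ht'
    have hb' : b ≤ n + 1 := by
      rcases Finset.mem_insert.1 hb with rfl | hb
      · exact le_rfl
      · have := hK' b hb
        omega
    rcases Finset.mem_union.1 ht with ht | ht <;> obtain ⟨a, ha, hae⟩ := Finset.mem_image.1 ht <;>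
      rw [Finset.mem_Icc] at ha
    · have h3 := hmem hae (v := n + 3) (by simp)
      simp only [Finset.mem_insert, Finset.mem_singleton] at h3
      omega
    · have h3 := hmem hae (v := n + 2) (by simp)
      simp only [Finset.mem_insert, Finset.mem_singleton] at h3
      omega

theorem card_compl_edges {n : ℕ} {G : RGraph 3 (n + 3)}
    (hm : G.edges.card = (n + 2).choose 3 + (n + 1).choose 2) : G.compl.edges.card = n + 1 := by
  have h : G.compl.edges.card + G.edges.card = (n + 3).choose 3 := by
    have := Finset.card_sdiff_add_card_eq_card G.edges_subset
    rwa [Finset.card_powersetCard, Nat.card_Icc] at this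
  have h1 : (n + 3).choose 3 = (n + 2).choose 2 + (n + 2).choose 3 := Nat.choose_succ_succ _ _
  have h2 : (n + 2).choose 2 = (n + 1).choose 1 + (n + 1).choose 2 := Nat.choose_succ_succ _ _
  rw [Nat.choose_one_right] at h2
  omega

theorem weight_complete_three (n : ℕ) (x : ℕ → ℝ) : (complete 3 n).weight x =
    ((∑ v ∈ Finset.Icc 1 n, x v) ^ 3 - 3 * (∑ v ∈ Finset.Icc 1 n, x v) *
      (∑ v ∈ Finset.Icc 1 n, x v ^ 2) + 2 * ∑ v ∈ Finset.Icc 1 n, x v ^ 3) / 6 :=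
  Finset.sum_powersetCard_three_prod x _

theorem exists_weight_eq {n i j : ℕ} (hj : 1 ≤ j) (hij : j ≤ i) {G : RGraph 3 (n + 3)}
    (hG : G.LeftCompressed)
    (hm : G.edges.card = (n + 2).choose 3 + (n + 1).choose 2)
    (hfirst : IsFirstColex (j + 1) G.compl.edges
      ((Finset.Icc (n + 1 - j) n).image (fun a => {a, n + 1, n + 2}) ∪
        {{n + 1 - i, n + 1, n + 3}})) :
    i ≤ n ∧ ∃ K ⊆ Finset.Icc 1 n, Finset.Icc (n + 1 - i) n ⊆ K ∧ i + j + K.card = n ∧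
      ∀ x, G.weight x = (complete 3 (n + 3)).weight x -
        nonedgeWeight n (Finset.Icc (n + 1 - j) n) (Finset.Icc (n + 1 - i) n) K x := by
  obtain ⟨hin, K, hK, hIK, hsum⟩ := exists_sum_compl_edges hj hij hG hfirst
  refine ⟨hin, K, hK, hIK, ?_, fun x => ?_⟩
  · have h := hsum fun _ => 1
    simp only [Finset.sum_const, card_compl_edges hm, Nat.card_Icc, nsmul_eq_mul, mul_one] at h
    have h' : n + 1 = (n + 1 - (n + 1 - j)) + (n + 1 - (n + 1 - i)) + (1 + K.card) := by
      exact_mod_cast h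
    omega
  · have hprod : ∀ a b c : ℕ, a ≠ b → a ≠ c → b ≠ c →
        ∏ v ∈ ({a, b, c} : Finset ℕ), x v = x b * x c * x a := by
      intro a b c hab hac hbc
      rw [Finset.prod_insert (by simp [hab, hac]), Finset.prod_pair hbc]
      ring
    rw [← weight_add_weight_compl, eq_sub_iff_add_eq, add_right_inj]
    unfold weight nonedgeWeight
    rw [hsum, hprod _ _ _ (by omega) (by omega) (by omega), Finset.mul_sum, Finset.mul_sum,
      Finset.mul_sum]
    rw [Finset.sum_congr rfl fun a ha => hprod a (n + 1) (n + 2) ?_ ?_ ?_,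
      Finset.sum_congr rfl fun a ha => hprod a (n + 1) (n + 3) ?_ ?_ ?_,
      Finset.sum_congr rfl fun a ha => hprod a (n + 2) (n + 3) ?_ ?_ ?_]
    · ring
    all_goals first | omega | skip
    all_goals first
      | (have := Finset.mem_Icc.1 ha; omega)
      | (have := Finset.mem_Icc.1 (hK ha); omega)

/-! ### Inequalities for the three last weights -/

/-- In the gaps q - r and p - q the difference of the sides has only nonnegative coefficients.
Equality at p = q = r shows that 8/9 cannot be lowered. -/
theorem two_mul_sq_mul_sq_add_le {p q r : ℝ} (hr : 0 ≤ r) (hrq : r ≤ q) (hqp : q ≤ p) :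
    2 * (q * r) ^ 2 + (p * q + p * r) ^ 2 ≤ 8 / 9 * (p + q + r) ^ 2 *
      ((r ^ 2 + (p - q) ^ 2) / 2 + (p - q - r) ^ 2 / 4 + q * (p - r)) := by
  obtain ⟨s, hs, rfl⟩ : ∃ s, 0 ≤ s ∧ q = r + s := ⟨q - r, by linarith, by ring⟩
  obtain ⟨v, hv, rfl⟩ : ∃ v, 0 ≤ v ∧ p = r + s + v := ⟨p - (r + s), by linarith, by ring⟩
  rw [← sub_nonneg]
  have h : 0 ≤ (48 * r ^ 2 * v ^ 2 + 57 * r ^ 2 * s ^ 2 + 48 * r ^ 2 * s * v +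
      108 * r * s * v ^ 2 + 74 * r * s ^ 3 + 102 * r * s ^ 2 * v + 40 * r * v ^ 3 +
      55 * s ^ 2 * v ^ 2 + 23 * s ^ 4 + 46 * s ^ 3 * v + 32 * s * v ^ 3 + 6 * v ^ 4) / 9 := by
    positivity
  refine h.trans_eq ?_
  ring

/-- With n replaced by 2i + j, both sides are linear in i and j; write i = (i - j) + j and compare
the coefficients of i - j and of j. The first uses 2p² ≤ κm, the second `two_mul_sq_mul_sq_add_le`.
Here 2(p-q-r)²/4 + r(p-q) = (r² + (p-q)²)/2. -/
theorem sq_sum_deviation_lt {n i j m κ p q r : ℝ} (hj : 0 < j) (hij : j ≤ i)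
    (hn : 2 * i + j ≤ n) (hr : 0 ≤ r) (hrq : r ≤ q) (hqp : q ≤ p) (hσ : 0 < p + q + r)
    (hκm : 0 < κ * m) (h1 : 4 / 9 * (p + q + r) ^ 2 < κ * m) (h2 : 2 * p ^ 2 ≤ κ * m) :
    (i + j) * (q * r) ^ 2 + (i - j) * (p * r) ^ 2 + j * (p * q + p * r) ^ 2 <
      2 * (κ * m) * (n * (p - q - r) ^ 2 / 4 + j * (q * (p - r)) + i * (r * (p - q))) := by
  have hq : 0 ≤ q := hr.trans hrq
  set c := κ * m
  have hR := two_mul_sq_mul_sq_add_le hr hrq hqp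
  set E := (r ^ 2 + (p - q) ^ 2) / 2 + (p - q - r) ^ 2 / 4 + q * (p - r) with hE
  have hqpr : 0 ≤ q * (p - r) := mul_nonneg hq (by linarith)
  have hE0 : 0 < E := by
    rcases hr.eq_or_lt with h0 | h0
    · rcases hq.eq_or_lt with h0' | h0'
      · have : 0 < p := by linarith
        rw [hE, ← h0, ← h0']
        ring_nf
        positivity
      · have : 0 < q * (p - r) := mul_pos h0' (by linarith)
        rw [hE]
        positivity
    · rw [hE]
      positivity
  have hR' : 2 * (q * r) ^ 2 + (p * q + p * r) ^ 2 < 2 * c * E := by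
    refine hR.trans_lt (mul_lt_mul_of_pos_right ?_ hE0)
    linarith
  have hI : (q * r) ^ 2 + (p * r) ^ 2 ≤ c * (r ^ 2 + (p - q) ^ 2) := by
    have hqp2 : q ^ 2 ≤ p ^ 2 := pow_le_pow_left₀ hq hqp 2
    calc (q * r) ^ 2 + (p * r) ^ 2 = (q ^ 2 + p ^ 2) * r ^ 2 := by ring
      _ ≤ c * r ^ 2 := mul_le_mul_of_nonneg_right (by linarith) (sq_nonneg r)
      _ ≤ c * (r ^ 2 + (p - q) ^ 2) :=
        mul_le_mul_of_nonneg_left (by linarith [sq_nonneg (p - q)]) hκm.le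
  have e1 := mul_le_mul_of_nonneg_left hI (sub_nonneg.2 hij)
  have e2 := mul_lt_mul_of_pos_left hR' hj
  have e3 : 2 * c * ((2 * i + j) * ((p - q - r) ^ 2 / 4)) ≤ 2 * c * (n * ((p - q - r) ^ 2 / 4)) := by
    gcongr
  rw [hE] at e2
  linarith

/-! ### Averaging the weights on the first n vertices -/

theorem sum_indicator_eq {T U : Finset ℕ} (hUT : U ⊆ T) (w : ℕ → ℝ) :
    ∑ v ∈ T, w v * (if v ∈ U then 1 else 0) = ∑ v ∈ U, w v := by
  simp only [mul_ite, mul_one, mul_zero]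
  rw [Finset.sum_ite_mem, Finset.inter_eq_right.2 hUT]

theorem sum_sq_eq_of_sum_eq {n : ℕ} {T : Finset ℕ} (hT : T.card = n) {w : ℕ → ℝ} {m : ℝ}
    (hm : ∑ v ∈ T, w v = n * m) :
    ∑ v ∈ T, w v ^ 2 = n * m ^ 2 + ∑ v ∈ T, (w v - m) ^ 2 := by
  have : ∑ v ∈ T, (w v - m) ^ 2 =
      ∑ v ∈ T, w v ^ 2 - 2 * m * ∑ v ∈ T, w v + ∑ v ∈ T, m ^ 2 := by
    rw [Finset.mul_sum, ← Finset.sum_sub_distrib, ← Finset.sum_add_distrib]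
    exact Finset.sum_congr rfl fun v _ => by ring
  rw [this, hm, Finset.sum_const, hT, nsmul_eq_mul]
  ring

/-- Sum the identity (w - m)²(w + 2m) = w³ - 3m²w + 2m³ and use w ≤ a. -/
theorem sum_cube_le_of_sum_eq {n : ℕ} {T : Finset ℕ} (hT : T.card = n) {w : ℕ → ℝ} {m a : ℝ}
    (hm : ∑ v ∈ T, w v = n * m) (hwa : ∀ v ∈ T, w v ≤ a) :
    ∑ v ∈ T, w v ^ 3 ≤ n * m ^ 3 + (a + 2 * m) * ∑ v ∈ T, (w v - m) ^ 2 := by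
  have h1 : ∑ v ∈ T, (w v - m) ^ 2 * (w v + 2 * m) ≤ (a + 2 * m) * ∑ v ∈ T, (w v - m) ^ 2 := by
    rw [Finset.mul_sum]
    refine Finset.sum_le_sum fun v hv => ?_
    rw [mul_comm]
    exact mul_le_mul_of_nonneg_right (by linarith [hwa v hv]) (sq_nonneg _)
  have h2 : ∑ v ∈ T, (w v - m) ^ 2 * (w v + 2 * m) =
      ∑ v ∈ T, w v ^ 3 - 3 * m ^ 2 * ∑ v ∈ T, w v + 2 * m * ∑ v ∈ T, m ^ 2 := by
    rw [Finset.mul_sum, Finset.mul_sum, ← Finset.sum_sub_distrib, ← Finset.sum_add_distrib]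
    exact Finset.sum_congr rfl fun v _ => by ring
  rw [h2, hm, Finset.sum_const, hT, nsmul_eq_mul] at h1
  linarith

/-- Removing the nonedges decreases the third elementary symmetric sum by more than averaging the
weights on `T` and replacing the weights `p, q, r` by two equal ones does. -/
theorem esymm_sub_nonedge_lt {n i j k : ℕ} (hn : 4 ≤ n) (hj : 1 ≤ j) (hij : j ≤ i) (hik : i ≤ k)
    (hijk : i + j + k = n) {T D I K : Finset ℕ} (hT : T.card = n) (hD : D.card = j)
    (hI : I.card = i) (hK : K.card = k) (hDI : D ⊆ I) (hIK : I ⊆ K) (hKT : K ⊆ T) {w : ℕ → ℝ}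
    {p q r a : ℝ} (hr : 0 ≤ r) (hrq : r ≤ q) (hqp : q ≤ p) (hpw : ∀ v ∈ T, p ≤ w v)
    (hwa : ∀ v ∈ T, w v ≤ a) (ha : a ≤ 1 / 3) (hσ : 0 < p + q + r) {m : ℝ}
    (hm : ∑ v ∈ T, w v = n * m) (hsum : n * m + (p + q + r) = 1) :
    (1 - 3 * (∑ v ∈ T, w v ^ 2 + (p ^ 2 + q ^ 2 + r ^ 2)) +
        2 * (∑ v ∈ T, w v ^ 3 + (p ^ 3 + q ^ 3 + r ^ 3))) / 6 -
        (p * q * r + p * q * ∑ v ∈ D, w v + p * r * ∑ v ∈ I, w v + q * r * ∑ v ∈ K, w v) <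
      (1 - 3 * (n * m ^ 2 + (p + q + r) ^ 2 / 2) + 2 * (n * m ^ 3 + (p + q + r) ^ 3 / 4)) / 6 := by
  have hn' : (4 : ℝ) ≤ n := by exact_mod_cast hn
  have hn0 : (0 : ℝ) < n := by linarith
  have hp : 0 ≤ p := hr.trans (hrq.trans hqp)
  have hpm : p ≤ m := by
    have := Finset.sum_le_sum hpw
    rw [hm, Finset.sum_const, hT, nsmul_eq_mul] at this
    exact le_of_mul_le_mul_left this hn0
  have hm0 : 0 < m := by
    by_contra h
    have : p = 0 := by linarith
    have : q = 0 := by linarith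
    linarith
  have hm4 : m ≤ 1 / 4 := by nlinarith
  -- Deviation V changes the symmetric sum by at most -V/2 + (a + 2m)V/3 = -κV/2.
  set κ := 1 - 2 / 3 * a - 4 / 3 * m with hκ
  have hκ0 : 0 < κ := by rw [hκ]; linarith
  set V := ∑ v ∈ T, (w v - m) ^ 2 with hV
  have hQ2 := sum_sq_eq_of_sum_eq hT hm
  have hQ3 := sum_cube_le_of_sum_eq hT hm hwa
  rw [← hV] at hQ2 hQ3
  let χ : Finset ℕ → ℕ → ℝ := fun U v => if v ∈ U then 1 else 0
  have hχ : ∀ U ⊆ T, ∑ v ∈ T, χ U v = U.card := by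
    intro U hU
    have := sum_indicator_eq hU fun _ => 1
    simpa only [one_mul, Finset.sum_const, nsmul_eq_mul, mul_one] using this
  let h : ℕ → ℝ := fun v => p * q * χ D v + p * r * χ I v + q * r * χ K v
  have hIT := hIK.trans hKT
  have hDT := hDI.trans hIT
  have hN : p * q * ∑ v ∈ D, w v + p * r * ∑ v ∈ I, w v + q * r * ∑ v ∈ K, w v =
      ∑ v ∈ T, w v * h v := by
    rw [← sum_indicator_eq hDT, ← sum_indicator_eq hIT, ← sum_indicator_eq hKT, Finset.mul_sum,
      Finset.mul_sum, Finset.mul_sum, ← Finset.sum_add_distrib, ← Finset.sum_add_distrib]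
    exact Finset.sum_congr rfl fun v _ => by simp only [h, χ]; ring
  have hh : ∑ v ∈ T, h v = p * q * j + p * r * i + q * r * k := by
    simp only [h]
    rw [Finset.sum_add_distrib, Finset.sum_add_distrib, ← Finset.mul_sum, ← Finset.mul_sum,
      ← Finset.mul_sum, hχ D hDT, hχ I hIT, hχ K hKT, hD, hI, hK]
  -- Since the deviations w - m sum to 0, any constant may be subtracted from h. Subtracting qr
  -- leaves 0 on K \ I, -qr off K (i + j vertices), pr on I \ D and pq + pr on D.
  have hh2 : ∑ v ∈ T, (h v - q * r) ^ 2 =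
      ((i : ℝ) + j) * (q * r) ^ 2 + (i - j) * (p * r) ^ 2 + j * (p * q + p * r) ^ 2 := by
    have : ∀ v ∈ T, (h v - q * r) ^ 2 = (q * r) ^ 2 * (1 - χ K v) +
        (p * r) ^ 2 * (χ I v - χ D v) + (p * q + p * r) ^ 2 * χ D v := by
      intro v _
      simp only [h, χ]
      by_cases hvD : v ∈ D
      · have hvI := hDI hvD
        have hvK := hIK hvI
        simp only [hvD, hvI, hvK, if_true]
        ring
      · by_cases hvI : v ∈ I
        · have hvK := hIK hvI
          simp only [hvD, hvI, hvK, if_true, if_false]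
          ring
        · by_cases hvK : v ∈ K <;> simp only [hvD, hvI, hvK, if_true, if_false] <;> ring
    rw [Finset.sum_congr rfl this, Finset.sum_add_distrib, Finset.sum_add_distrib,
      ← Finset.mul_sum, ← Finset.mul_sum, ← Finset.mul_sum, Finset.sum_sub_distrib,
      Finset.sum_sub_distrib, hχ D hDT, hχ I hIT, hχ K hKT, hD, hI, hK, Finset.sum_const, hT,
      ← hijk]
    simp only [nsmul_eq_mul]
    push_cast
    ring
  have hcross : ∑ v ∈ T, w v * h v = m * ∑ v ∈ T, h v + ∑ v ∈ T, (w v - m) * (h v - q * r) := by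
    have h1 : ∑ v ∈ T, (w v - m) * (h v - q * r) = ∑ v ∈ T, w v * h v - m * ∑ v ∈ T, h v -
        q * r * (∑ v ∈ T, w v - ∑ v ∈ T, m) := by
      rw [Finset.mul_sum, ← Finset.sum_sub_distrib, ← Finset.sum_sub_distrib, Finset.mul_sum,
        ← Finset.sum_sub_distrib]
      exact Finset.sum_congr rfl fun v _ => by ring
    rw [h1, hm, Finset.sum_const, hT, nsmul_eq_mul]
    ring
  have hyoung : 0 ≤ κ ^ 2 * V + 2 * κ * ∑ v ∈ T, (w v - m) * (h v - q * r) +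
      ∑ v ∈ T, (h v - q * r) ^ 2 := by
    rw [hV, Finset.mul_sum, Finset.mul_sum, ← Finset.sum_add_distrib, ← Finset.sum_add_distrib]
    refine Finset.sum_nonneg fun v _ => ?_
    have := sq_nonneg (κ * (w v - m) + (h v - q * r))
    linarith
  have hp5 : p ≤ 1 / 5 := by nlinarith
  have hκm : 0 < κ * m := mul_pos hκ0 hm0
  -- With σ = p + q + r: σ ≤ 3m and 4m + σ ≤ 1 give σ ≤ 3/7, while a ≤ 1/3 gives κ ≥ 4/9 + σ/3.
  -- Hence 4σ/3 < κ, as 3/7 < 4/9.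
  have hb1 : 4 / 9 * (p + q + r) ^ 2 < κ * m := by
    have h4 : 4 * m ≤ n * m := mul_le_mul_of_nonneg_right hn' hm0.le
    have hσκ : 4 / 3 * (p + q + r) < κ := by rw [hκ]; linarith
    calc 4 / 9 * (p + q + r) ^ 2 = 4 / 9 * (p + q + r) * (p + q + r) := by ring
      _ ≤ 4 / 9 * (p + q + r) * (3 * m) := mul_le_mul_of_nonneg_left (by linarith) (by linarith)
      _ = 4 / 3 * (p + q + r) * m := by ring
      _ < κ * m := mul_lt_mul_of_pos_right hσκ hm0
  have hb2 : 2 * p ^ 2 ≤ κ * m := by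
    have : 2 * p ≤ κ := by rw [hκ]; linarith
    calc 2 * p ^ 2 = 2 * p * p := by ring
      _ ≤ κ * m := mul_le_mul this hpm hp hκ0.le
  have hijk' : (i : ℝ) + j + k = n := by exact_mod_cast hijk
  have hdev := sq_sum_deviation_lt (n := n) (i := i) (j := j) (m := m) (κ := κ)
    (by exact_mod_cast hj) (by exact_mod_cast hij)
    (by have : (i : ℝ) ≤ k := by exact_mod_cast hik
        linarith) hr hrq hqp hσ hκm hb1 hb2
  rw [← hh2] at hdev
  have hfin : -∑ v ∈ T, (w v - m) * (h v - q * r) - κ / 2 * V <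
      m * (n * (p - q - r) ^ 2 / 4 + j * (q * (p - r)) + i * (r * (p - q))) := by
    refine lt_of_mul_lt_mul_left ?_ (by positivity : (0 : ℝ) ≤ 2 * κ)
    linarith
  have hS : (n : ℝ) * m = 1 - (p + q + r) := by linarith
  -- The exact gain for constant w: pqr cancels against the nonedge {n+1, n+2, n+3}, and k = n - i -
  -- j turns the rest into (p+q+r)²/4 - p(q+r) = (p-q-r)²/4 plus the j and i terms.
  have hid : (1 - 3 * (n * m ^ 2 + (p + q + r) ^ 2 / 2) +
      2 * (n * m ^ 3 + (p + q + r) ^ 3 / 4)) / 6 -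
      ((1 - 3 * (n * m ^ 2 + (p ^ 2 + q ^ 2 + r ^ 2)) +
        2 * (n * m ^ 3 + (p ^ 3 + q ^ 3 + r ^ 3))) / 6 - p * q * r -
        m * (p * q * j + p * r * i + q * r * k)) =
      m * (n * (p - q - r) ^ 2 / 4 + j * (q * (p - r)) + i * (r * (p - q))) := by
    have hk : (k : ℝ) = n - i - j := by linarith
    rw [hk]
    linear_combination (-(p + q + r) ^ 2 / 4 + (p * q + p * r + q * r)) * hS
  rw [show ∀ a b c d : ℝ, a + b + c + d = a + (b + c + d) from fun a b c d => by ring, hN, hcross,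
    hh, hQ2]
  have hκV : κ / 2 * V = V / 2 - (a + 2 * m) * V / 3 := by rw [hκ]; ring
  linarith

/-! ### Lower bounds for the Lagrangian of the complete graph -/

theorem sum_Icc_add_three (n : ℕ) (f : ℕ → ℝ) :
    ∑ v ∈ Finset.Icc 1 (n + 3), f v =
      ∑ v ∈ Finset.Icc 1 n, f v + (f (n + 1) + f (n + 2) + f (n + 3)) := by
  rw [Finset.sum_Icc_succ_top (by omega), Finset.sum_Icc_succ_top (by omega),
    Finset.sum_Icc_succ_top (by omega)]
  ring

theorem weight_le_lagrangian {r n : ℕ} (G : RGraph r n) (hn : 1 ≤ n) {x : ℕ → ℝ}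
    (hx : x ∈ weightings n) : G.weight x ≤ G.lagrangian :=
  (G.isGreatest_lagrangian hn).2 ⟨x, hx, rfl⟩

theorem weight_const_mul {r n : ℕ} (G : RGraph r n) (c : ℝ) (x : ℕ → ℝ) :
    G.weight (fun v => c * x v) = c ^ r * G.weight x := by
  unfold weight
  rw [Finset.mul_sum]
  refine Finset.sum_congr rfl fun e he => ?_
  rw [Finset.prod_mul_distrib, Finset.prod_const,
    (Finset.mem_powersetCard.1 (G.edges_subset he)).2]

theorem two_block_le_lagrangian_complete (n : ℕ) {m σ : ℝ} (hm : 0 ≤ m) (hσ : 0 ≤ σ)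
    (hsum : n * m + σ = 1) :
    (1 - 3 * (n * m ^ 2 + σ ^ 2 / 2) + 2 * (n * m ^ 3 + σ ^ 3 / 4)) / 6 ≤
      (complete 3 (n + 2)).lagrangian := by
  let y : ℕ → ℝ := fun v => if v ∈ Finset.Icc 1 n then m else
    if v ∈ Finset.Icc 1 (n + 2) then σ / 2 else 0
  have hy : ∀ v ∈ Finset.Icc 1 n, y v = m := fun v hv => if_pos hv
  have hy1 : y (n + 1) = σ / 2 := by simp [y]
  have hy2 : y (n + 2) = σ / 2 := by simp [y]
  have hpow : ∀ k : ℕ, ∑ v ∈ Finset.Icc 1 (n + 2), y v ^ k =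
      n * m ^ k + 2 * (σ / 2) ^ k := by
    intro k
    rw [Finset.sum_Icc_succ_top (by omega), Finset.sum_Icc_succ_top (by omega), hy1, hy2,
      Finset.sum_congr rfl fun v hv => by rw [hy v hv]]
    simp only [Finset.sum_const, Nat.card_Icc, nsmul_eq_mul, Nat.add_sub_cancel]
    ring
  have hsum1 : ∑ v ∈ Finset.Icc 1 (n + 2), y v = 1 := by
    have := hpow 1
    simp only [pow_one] at this
    rw [this]
    linarith
  have hmem : y ∈ weightings (n + 2) := by
    refine ⟨fun v => ?_, fun v hv => ?_, hsum1⟩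
    · simp only [y]
      split_ifs <;> positivity
    · have : v ∉ Finset.Icc 1 n := by
        rw [Finset.mem_Icc] at hv ⊢
        omega
      simp only [y, if_neg hv, if_neg this]
  refine le_trans (le_of_eq ?_) (weight_le_lagrangian _ (by omega) hmem)
  rw [weight_complete_three, hsum1, hpow, hpow]
  ring

theorem uniform_le_lagrangian_complete (n : ℕ) :
    (n * (n + 1) : ℝ) / (6 * (n + 2) ^ 2) ≤ (complete 3 (n + 2)).lagrangian := by
  have hn : (0 : ℝ) < n + 2 := by positivity
  refine le_trans (le_of_eq ?_) (two_block_le_lagrangian_complete n (m := 1 / (n + 2))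
    (σ := 2 / (n + 2)) (by positivity) (by positivity) (by field_simp))
  field_simp
  ring

/-! ### An ordered maximizer -/

theorem swap_apply_eq (x : ℕ → ℝ) {u w : ℕ} (huw : u ≠ w) (v : ℕ) :
    x (Equiv.swap u w v) =
      x v + (if v = u then x w - x u else 0) - (if v = w then x w - x u else 0) := by
  by_cases h1 : v = u
  · subst h1
    simp [huw]
  · by_cases h2 : v = w
    · subst h2
      simp [h1]
    · simp [Equiv.swap_apply_of_ne_of_ne h1 h2, h1, h2]

theorem sum_swap_eq (x : ℕ → ℝ) {u w : ℕ} (huw : u ≠ w) (c : ℕ → ℝ) (U : Finset ℕ) :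
    ∑ v ∈ U, c v * x (Equiv.swap u w v) = ∑ v ∈ U, c v * x v +
      (if u ∈ U then c u * (x w - x u) else 0) - (if w ∈ U then c w * (x w - x u) else 0) := by
  have h : ∀ v ∈ U, c v * x (Equiv.swap u w v) = c v * x v +
      (if v = u then c v * (x w - x u) else 0) - (if v = w then c v * (x w - x u) else 0) := by
    intro v _
    rw [swap_apply_eq x huw]
    split_ifs <;> ring
  rw [Finset.sum_congr rfl h, Finset.sum_sub_distrib, Finset.sum_add_distrib, Finset.sum_ite_eq',
    Finset.sum_ite_eq']

theorem weight_complete_swap {n u w : ℕ} (hu : u ∈ Finset.Icc 1 n) (hw : w ∈ Finset.Icc 1 n)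
    (x : ℕ → ℝ) :
    (complete 3 n).weight (fun v => x (Equiv.swap u w v)) = (complete 3 n).weight x := by
  have hs : ∀ f : ℕ → ℝ, ∑ v ∈ Finset.Icc 1 n, f (Equiv.swap u w v) =
      ∑ v ∈ Finset.Icc 1 n, f v := by
    intro f
    refine Equiv.Perm.sum_comp _ _ _ fun v hv => ?_
    by_contra h
    refine hv (Equiv.swap_apply_of_ne_of_ne ?_ ?_) <;> rintro rfl
    · exact h hu
    · exact h hw
  rw [weight_complete_three, weight_complete_three, hs x, hs fun v => x v ^ 2,
    hs fun v => x v ^ 3]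

theorem swap_mem_weightings {n u w : ℕ} (hu : u ∈ Finset.Icc 1 n) (hw : w ∈ Finset.Icc 1 n)
    (huw : u ≠ w) {x : ℕ → ℝ} (hx : x ∈ weightings n) :
    (fun v => x (Equiv.swap u w v)) ∈ weightings n := by
  obtain ⟨h0, h1, h2⟩ := hx
  refine ⟨fun v => h0 _, fun v hv => ?_, ?_⟩
  · have hvu : v ≠ u := fun h => hv (h ▸ hu)
    have hvw : v ≠ w := fun h => hv (h ▸ hw)
    simpa only [Equiv.swap_apply_of_ne_of_ne hvu hvw] using h1 v hv
  · have := sum_swap_eq x huw (fun _ => 1) (Finset.Icc 1 n)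
    simp only [one_mul, hu, hw, if_true, h2] at this
    linarith

/-- Some maximizer is monotone at every pair of vertices whose exchange does not decrease
the weight. -/
theorem exists_maximizer_of_swap {r n : ℕ} (G : RGraph r n) (hn : 1 ≤ n) :
    ∃ x ∈ weightings n, G.weight x = G.lagrangian ∧
      ∀ u ∈ Finset.Icc 1 n, ∀ w ∈ Finset.Icc 1 n, u < w →
        (x u < x w → G.weight x ≤ G.weight fun v => x (Equiv.swap u w v)) → x w ≤ x u := by
  have hcont : Continuous G.weight := by
    unfold weight
    fun_prop
  have hcomp : IsCompact (weightings n ∩ {x | G.weight x = G.lagrangian}) :=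
    (isCompact_weightings n).inter_right (isClosed_eq hcont continuous_const)
  obtain ⟨x₀, hx₀, hx₀'⟩ := (G.isGreatest_lagrangian hn).1
  -- Among the maximizers, one minimizing ∑ v x_v is chosen: exchanging weights with x u < x w and u
  -- < w would lower this sum.
  obtain ⟨x, ⟨hx, hxm⟩, hmin⟩ := hcomp.exists_isMinOn ⟨x₀, hx₀, hx₀'⟩
    (f := fun x : ℕ → ℝ => ∑ v ∈ Finset.Icc 1 n, (v : ℝ) * x v) (by fun_prop)
  have hxm' : G.weight x = G.lagrangian := hxm
  refine ⟨x, hx, hxm', fun u hu w hw huw hsw => ?_⟩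
  by_contra hlt
  have hlt := not_le.1 hlt
  have hmem := swap_mem_weightings hu hw huw.ne hx
  have h1 := hmin ⟨hmem, le_antisymm (weight_le_lagrangian G hn hmem) (hxm' ▸ hsw hlt)⟩
  simp only [Set.mem_ofPred_eq] at h1
  rw [sum_swap_eq x huw.ne (fun v => (v : ℝ)), if_pos hu, if_pos hw] at h1
  have huw' : (u : ℝ) < w := by exact_mod_cast huw
  nlinarith

/-- For the last two pairs of vertices this is D ⊆ I and I ⊆ K. For u in [n] and w = n + 1, an
increase of the sum over D or I is paid for because x u is one of its summands, and that of K by the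
triple {n+1, n+2, n+3}. -/
theorem nonedgeWeight_swap_le {n : ℕ} {D I K : Finset ℕ} (hDI : D ⊆ I) (hIK : I ⊆ K)
    (hK : K ⊆ Finset.Icc 1 n) {x : ℕ → ℝ} (hx : ∀ v, 0 ≤ x v) {u w : ℕ}
    (h : u = n + 2 ∧ w = n + 3 ∨ u = n + 1 ∧ w = n + 2 ∨ u ∈ Finset.Icc 1 n ∧ w = n + 1)
    (hxuw : x u < x w) :
    nonedgeWeight n D I K (fun v => x (Equiv.swap u w v)) ≤ nonedgeWeight n D I K x := by
  have huw : u ≠ w := by rintro rfl; exact lt_irrefl _ hxuw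
  have hout : ∀ v, n < v → v ∉ K := fun v hv hvK => by
    have := Finset.mem_Icc.1 (hK hvK)
    omega
  have hs : ∀ U, ∑ v ∈ U, x (Equiv.swap u w v) = ∑ v ∈ U, x v +
      (if u ∈ U then x w - x u else 0) - (if w ∈ U then x w - x u else 0) := by
    intro U
    simpa using sum_swap_eq x huw (fun _ => 1) U
  have hwK : w ∉ K := hout w (by omega)
  have hwI : w ∉ I := fun h => hwK (hIK h)
  have hwD : w ∉ D := fun h => hwI (hDI h)
  have hsDI : ∑ v ∈ D, x v ≤ ∑ v ∈ I, x v :=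
    Finset.sum_le_sum_of_subset_of_nonneg hDI fun v _ _ => hx v
  have hsIK : ∑ v ∈ I, x v ≤ ∑ v ∈ K, x v :=
    Finset.sum_le_sum_of_subset_of_nonneg hIK fun v _ _ => hx v
  have hp := hx (n + 1)
  have hq := hx (n + 2)
  have hr := hx (n + 3)
  unfold nonedgeWeight
  rw [hs, hs, hs, if_neg hwK, if_neg hwI, if_neg hwD]
  beta_reduce
  rcases h with ⟨rfl, rfl⟩ | ⟨rfl, rfl⟩ | ⟨hu, rfl⟩
  · have huK := hout (n + 2) (by omega)
    rw [if_neg huK, if_neg fun h => huK (hIK h), if_neg fun h => huK (hIK (hDI h)),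
      Equiv.swap_apply_left, Equiv.swap_apply_right,
      Equiv.swap_apply_of_ne_of_ne (by omega) (by omega)]
    have := mul_nonneg (mul_nonneg hp (sub_nonneg.2 hxuw.le)) (sub_nonneg.2 hsDI)
    linarith
  · have huK := hout (n + 1) (by omega)
    rw [if_neg huK, if_neg fun h => huK (hIK h), if_neg fun h => huK (hIK (hDI h)),
      Equiv.swap_apply_left, Equiv.swap_apply_right,
      Equiv.swap_apply_of_ne_of_ne (by omega) (by omega)]
    have := mul_nonneg (mul_nonneg hr (sub_nonneg.2 hxuw.le)) (sub_nonneg.2 hsIK)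
    linarith
  · rw [Finset.mem_Icc] at hu
    rw [Equiv.swap_apply_right, Equiv.swap_apply_of_ne_of_ne (by omega) (by omega),
      Equiv.swap_apply_of_ne_of_ne (by omega) (by omega)]
    set δ := x (n + 1) - x u with hδ
    have hδ0 : 0 ≤ δ := by linarith
    have hε : ∀ U : Finset ℕ, x u * (if u ∈ U then δ else 0) ≤ δ * ∑ v ∈ U, x v := by
      intro U
      split_ifs with hU
      · rw [mul_comm]
        exact mul_le_mul_of_nonneg_left (Finset.single_le_sum (fun v _ => hx v) hU) hδ0
      · rw [mul_zero]
        exact mul_nonneg hδ0 (Finset.sum_nonneg fun v _ => hx v)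
    have hεK : (if u ∈ K then δ else 0) ≤ δ := by split_ifs <;> linarith
    have e1 := mul_le_mul_of_nonneg_left (hε D) hq
    have e2 := mul_le_mul_of_nonneg_left (hε I) hr
    have e3 := mul_le_mul_of_nonneg_left hεK (mul_nonneg hq hr)
    have hpu : x (n + 1) = x u + δ := by rw [hδ]; ring
    rw [hpu]
    linarith

/-! ### No large weight in a maximizer -/

theorem nonedgeWeight_sub_le {n : ℕ} {D I K : Finset ℕ} {x : ℕ → ℝ} (hx : ∀ v, 0 ≤ x v) {u : ℕ}
    (hu : u ∈ Finset.Icc 1 n) {s : ℝ} (hs : 0 ≤ s) :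
    nonedgeWeight n D I K (fun v => x v - if v = u then s else 0) ≤ nonedgeWeight n D I K x := by
  rw [Finset.mem_Icc] at hu
  have hle : ∀ U : Finset ℕ, ∑ v ∈ U, (x v - if v = u then s else 0) ≤ ∑ v ∈ U, x v :=
    fun U => Finset.sum_le_sum fun v _ => by split_ifs <;> linarith
  have h1 : n + 1 ≠ u := by omega
  have h2 : n + 2 ≠ u := by omega
  have h3 : n + 3 ≠ u := by omega
  unfold nonedgeWeight
  simp only [h1, h2, h3, if_false, sub_zero]
  have hp := hx (n + 1)
  have hq := hx (n + 2)
  have hr := hx (n + 3)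
  gcongr _ + _ * ?_ + _ * ?_ + _ * ?_
  exacts [hle D, hle I, hle K]

/-- If the Lagrangian is at least that of `[6]^(3)`, then a maximizer has no weight above `1 / 3` on
`{1, …, n}`. -/
theorem maximizer_le_third {n : ℕ} {D I K : Finset ℕ} {G : RGraph 3 (n + 3)}
    (hw : ∀ x, G.weight x = (complete 3 (n + 3)).weight x - nonedgeWeight n D I K x)
    {x : ℕ → ℝ} (hx : x ∈ weightings (n + 3)) (hmax : G.weight x = G.lagrangian)
    (hbig : 5 / 54 ≤ G.lagrangian) {u : ℕ} (hu : u ∈ Finset.Icc 1 n) : x u ≤ 1 / 3 := by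
  obtain ⟨h0, h1, h2⟩ := hx
  have hu3 : u ∈ Finset.Icc 1 (n + 3) := by
    rw [Finset.mem_Icc] at hu ⊢
    omega
  by_contra hlt
  have hlt := not_le.1 hlt
  set a := x u with ha
  have ha1 : a ≤ 1 := h2 ▸ Finset.single_le_sum (fun w _ => h0 w) hu3
  -- Half of the weight at u is removed and the rest rescaled to total 1; by maximality the value
  -- does not grow.
  set s := a / 2 with hs
  have hs1 : 0 < 1 - s := by linarith
  let z : ℕ → ℝ := fun v => x v - if v = u then s else 0
  have hz0 : ∀ v, 0 ≤ z v := by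
    intro v
    simp only [z]
    split_ifs with hv
    · rw [hv, ← ha]
      linarith
    · linarith [h0 v]
  have hpow : ∀ k : ℕ, ∑ v ∈ Finset.Icc 1 (n + 3), z v ^ (k + 1) =
      ∑ v ∈ Finset.Icc 1 (n + 3), x v ^ (k + 1) - a ^ (k + 1) + (a - s) ^ (k + 1) := by
    intro k
    rw [← Finset.add_sum_erase _ _ hu3, ← Finset.add_sum_erase _ (fun v => x v ^ (k + 1)) hu3,
      Finset.sum_congr rfl fun v hv => ?_]
    · simp only [z, if_true, ← ha]
      ring
    · simp only [z, if_neg (Finset.ne_of_mem_erase hv), sub_zero]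
  have hz1 : ∑ v ∈ Finset.Icc 1 (n + 3), z v = 1 - s := by
    have := hpow 0
    simp only [zero_add, pow_one, h2] at this
    rw [this]
    ring
  have hy : (fun v => (1 - s)⁻¹ * z v) ∈ weightings (n + 3) := by
    refine ⟨fun v => mul_nonneg (inv_nonneg.2 hs1.le) (hz0 v), fun v hv => ?_, ?_⟩
    · have : v ≠ u := fun h => hv (h ▸ hu3)
      simp [z, this, h1 v hv]
    · rw [← Finset.mul_sum, hz1, inv_mul_cancel₀ hs1.ne']
  have hyw := weight_le_lagrangian G (by omega) hy
  rw [weight_const_mul, inv_pow, inv_mul_le_iff₀ (by positivity)] at hyw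
  have hN : nonedgeWeight n D I K z ≤ nonedgeWeight n D I K x :=
    nonedgeWeight_sub_le h0 hu (by linarith)
  have hxw := hw x
  rw [weight_complete_three, h2, hmax] at hxw
  rw [hw z, weight_complete_three, hz1, hpow 1, hpow 2] at hyw
  have hP2 : a ^ 2 ≤ ∑ v ∈ Finset.Icc 1 (n + 3), x v ^ 2 :=
    Finset.single_le_sum (f := fun v => x v ^ 2) (fun w _ => sq_nonneg _) hu3
  norm_num at hyw
  set f := G.lagrangian
  -- The removal loses at most s times the second symmetric sum of the other weights, which total 1
  -- - a.
  have hmain : f - s * (1 - a) ^ 2 / 2 ≤ (1 - s) ^ 3 * f := by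
    have : 0 ≤ s * (∑ v ∈ Finset.Icc 1 (n + 3), x v ^ 2 - a ^ 2) :=
      mul_nonneg (by linarith) (sub_nonneg.2 hP2)
    linarith
  have hdiv : (3 - 3 * s + s ^ 2) * f ≤ (1 - a) ^ 2 / 2 := by
    refine le_of_mul_le_mul_left ?_ (by linarith : 0 < s)
    linarith
  have hf : (3 - 3 * s) * (5 / 54) ≤ (3 - 3 * s + s ^ 2) * f := by
    refine mul_le_mul (by linarith [sq_nonneg s]) hbig (by norm_num) ?_
    linarith [sq_nonneg s]
  nlinarith

/-! ### The small and the degenerate case -/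

/-- The nonedges are exactly the four triples inside {3, 4, 5, 6}, so equalizing within {1, 2} and
within {3, 4, 5, 6} leaves a cubic in one variable. The bound 2/25 is the Lagrangian of [5]^(3). -/
theorem weight_lt_of_three {D : Finset ℕ} (hD : D = {3}) {x : ℕ → ℝ} (hx : x ∈ weightings 6) :
    (complete 3 6).weight x - nonedgeWeight 3 D D D x < 2 / 25 := by
  obtain ⟨h0, -, h2⟩ := hx
  have hI : Finset.Icc 1 6 = {1, 2, 3, 4, 5, 6} := by decide
  have hsum : ∀ f : ℕ → ℝ, ∑ v ∈ Finset.Icc 1 6, f v = f 1 + f 2 + f 3 + f 4 + f 5 + f 6 := by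
    intro f
    rw [hI]
    simp
    ring
  rw [hsum] at h2
  set u := x 1 + x 2 with hu
  set τ := x 3 + x 4 + x 5 + x 6 with hτ
  have hu0 : 0 ≤ u := add_nonneg (h0 1) (h0 2)
  have hτ0 : 0 ≤ τ := by
    have := h0 3; have := h0 4; have := h0 5; have := h0 6
    linarith
  have huτ : u = 1 - τ := by linarith
  have hval : (complete 3 6).weight x - nonedgeWeight 3 D D D x =
      x 1 * x 2 * τ + u * (x 3 * x 4 + x 3 * x 5 + x 3 * x 6 + x 4 * x 5 + x 4 * x 6 +
        x 5 * x 6) := by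
    rw [weight_complete_three, hsum, hsum, hsum, hD, hτ, hu]
    unfold nonedgeWeight
    simp only [Finset.sum_singleton]
    norm_num
    ring
  have h12 : x 1 * x 2 ≤ u ^ 2 / 4 := by
    rw [hu]
    linarith [sq_nonneg (x 1 - x 2)]
  have h3456 : x 3 * x 4 + x 3 * x 5 + x 3 * x 6 + x 4 * x 5 + x 4 * x 6 + x 5 * x 6 ≤
      3 / 8 * τ ^ 2 := by
    rw [hτ]
    linarith [sq_nonneg (x 3 - x 4), sq_nonneg (x 3 - x 5), sq_nonneg (x 3 - x 6),
      sq_nonneg (x 4 - x 5), sq_nonneg (x 4 - x 6), sq_nonneg (x 5 - x 6)]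
  rw [hval]
  have e1 := mul_le_mul_of_nonneg_right h12 hτ0
  have e2 := mul_le_mul_of_nonneg_left h3456 hu0
  -- The cubic is τ(1 - τ)(2 + τ)/8, with maximum near τ = 11/20; this is its tangent-line bound
  -- there.
  have e3 : 0 ≤ (τ - 11 / 20) ^ 2 * (τ + 21 / 10) := by positivity
  rw [huτ] at e1 e2 ⊢
  linarith

theorem weight_lt_of_sum_eq_one {n : ℕ} (hn : 4 ≤ n) {w : ℕ → ℝ}
    (hw : ∑ v ∈ Finset.Icc 1 n, w v = 1)
    (hwa : ∀ v ∈ Finset.Icc 1 n, w v ≤ 1 / 3) :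
    (1 - 3 * ∑ v ∈ Finset.Icc 1 n, w v ^ 2 + 2 * ∑ v ∈ Finset.Icc 1 n, w v ^ 3) / 6 <
      (n * (n + 1) : ℝ) / (6 * (n + 2) ^ 2) := by
  have hn' : (4 : ℝ) ≤ n := by exact_mod_cast hn
  have hn0 : (0 : ℝ) < n := by linarith
  have hT : (Finset.Icc 1 n).card = n := by simp
  have hm : ∑ v ∈ Finset.Icc 1 n, w v = n * (1 / n : ℝ) := by
    rw [hw]
    field_simp
  have hQ2 := sum_sq_eq_of_sum_eq hT hm
  have hQ3 := sum_cube_le_of_sum_eq hT hm hwa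
  have hm4 : (1 / n : ℝ) ≤ 1 / 4 := one_div_le_one_div_of_le (by norm_num) hn'
  set V := ∑ v ∈ Finset.Icc 1 n, (w v - 1 / n) ^ 2
  have hV : 0 ≤ V := Finset.sum_nonneg fun v _ => sq_nonneg _
  have hle : (1 / 3 + 2 * (1 / n : ℝ)) * V ≤ V := by
    refine mul_le_of_le_one_left hV ?_
    linarith
  have hlt : (1 - 3 * (n * (1 / n : ℝ) ^ 2) + 2 * (n * (1 / n : ℝ) ^ 3)) / 6 <
      (n * (n + 1) : ℝ) / (6 * (n + 2) ^ 2) := by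
    rw [show (1 - 3 * (n * (1 / n : ℝ) ^ 2) + 2 * (n * (1 / n : ℝ) ^ 3)) / 6 =
      (n ^ 2 - 3 * n + 2 : ℝ) / (6 * n ^ 2) by field_simp, div_lt_div_iff₀ (by positivity)
      (by positivity)]
    nlinarith
  refine lt_of_le_of_lt ?_ hlt
  linarith

/-! ### Conclusion -/

theorem lagrangian_lt_of_weight_eq {n i j : ℕ} (hj : 1 ≤ j) (hij : j ≤ i) {K : Finset ℕ}
    (hin : i ≤ n) (hK : K ⊆ Finset.Icc 1 n) (hIK : Finset.Icc (n + 1 - i) n ⊆ K)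
    (hcard : i + j + K.card = n) {G : RGraph 3 (n + 3)}
    (hw : ∀ x, G.weight x = (complete 3 (n + 3)).weight x -
      nonedgeWeight n (Finset.Icc (n + 1 - j) n) (Finset.Icc (n + 1 - i) n) K x) :
    G.lagrangian < (complete 3 (n + 2)).lagrangian := by
  set D := Finset.Icc (n + 1 - j) n with hD
  set I := Finset.Icc (n + 1 - i) n with hI
  have hDI : D ⊆ I := Finset.Icc_subset_Icc (by omega) le_rfl
  have hDc : D.card = j := by rw [hD, Nat.card_Icc]; omega
  have hIc : I.card = i := by rw [hI, Nat.card_Icc]; omega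
  have hik : i ≤ K.card := hIc ▸ Finset.card_le_card hIK
  obtain ⟨x, hx, hmax, hswap⟩ := G.exists_maximizer_of_swap (by omega)
  have hunif := uniform_le_lagrangian_complete n
  -- Here n = i + j + |K| with |K| ≥ i ≥ j ≥ 1, so n = 3 only for i = j = |K| = 1.
  rcases (by omega : n = 3 ∨ 4 ≤ n) with rfl | hn
  · obtain rfl : j = 1 := by omega
    obtain rfl : i = 1 := by omega
    have hID : I = D := hI.trans hD.symm
    have hKI : K = I := (Finset.eq_of_subset_of_card_le hIK (by omega)).symm
    rw [← hmax, hw, hKI, hID]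
    refine (weight_lt_of_three (by rw [hD]; rfl) hx).trans_le ?_
    norm_num at hunif ⊢
    exact hunif
  by_contra hcon
  have hcon := not_lt.1 hcon
  have hn' : (4 : ℝ) ≤ n := by exact_mod_cast hn
  have hn0 : (0 : ℝ) < n := by linarith
  -- The uniform value n(n+1)/(6(n+2)²) is at least its value 5/54 at n = 4.
  have hbig : 5 / 54 ≤ G.lagrangian := by
    refine le_trans ?_ (hunif.trans hcon)
    rw [div_le_div_iff₀ (by norm_num) (by positivity)]
    nlinarith
  have hmem : ∀ v, 1 ≤ v → v ≤ n + 3 → v ∈ Finset.Icc 1 (n + 3) := fun v h h' =>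
    Finset.mem_Icc.2 ⟨h, h'⟩
  have hord : ∀ u w, u = n + 2 ∧ w = n + 3 ∨ u = n + 1 ∧ w = n + 2 ∨
      u ∈ Finset.Icc 1 n ∧ w = n + 1 → x w ≤ x u := by
    intro u w huw
    have h1 : 1 ≤ u ∧ u < w ∧ w ≤ n + 3 := by
      rw [Finset.mem_Icc] at huw
      omega
    refine hswap u (hmem _ (by omega) (by omega)) w (hmem _ (by omega) (by omega)) h1.2.1
      fun hlt => ?_
    rw [hw, hw, weight_complete_swap (hmem _ (by omega) (by omega)) (hmem _ (by omega) (by omega))]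
    exact sub_le_sub_left (nonedgeWeight_swap_le hDI hIK hK hx.1 huw hlt) _
  have hthird : ∀ v ∈ Finset.Icc 1 n, x v ≤ 1 / 3 := fun v hv =>
    maximizer_le_third hw hx hmax hbig hv
  obtain ⟨h0, -, h2⟩ := hx
  have hr := h0 (n + 3)
  have hrq := hord _ _ (Or.inl ⟨rfl, rfl⟩)
  have hqp := hord _ _ (Or.inr (Or.inl ⟨rfl, rfl⟩))
  have hpw := fun v hv => hord v (n + 1) (Or.inr (Or.inr ⟨hv, rfl⟩))
  have hval := hw x
  rw [weight_complete_three, h2, sum_Icc_add_three, sum_Icc_add_three, hmax] at hval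
  rw [sum_Icc_add_three] at h2
  unfold nonedgeWeight at hval
  set p := x (n + 1)
  set q := x (n + 2)
  set r := x (n + 3)
  have hT : (Finset.Icc 1 n).card = n := by simp
  rcases (by linarith : 0 ≤ p + q + r).eq_or_lt with hσ | hσ
  · have hp0 : p = 0 := by linarith
    have hq0 : q = 0 := by linarith
    have hr0 : r = 0 := by linarith
    rw [hp0, hq0, hr0] at h2 hval
    have := weight_lt_of_sum_eq_one hn (by linarith) hthird
    norm_num at hval
    linarith
  · have hm : ∑ v ∈ Finset.Icc 1 n, x v = n * ((∑ v ∈ Finset.Icc 1 n, x v) / n) := by field_simp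
    have hlt := esymm_sub_nonedge_lt hn hj hij hik hcard hT hDc hIc rfl hDI hIK hK hr hrq hqp hpw
      hthird le_rfl hσ hm (by rw [← hm]; exact h2)
    have hle := two_block_le_lagrangian_complete n
      (div_nonneg (Finset.sum_nonneg fun v _ => h0 v) hn0.le) hσ.le (by rw [← hm]; exact h2)
    norm_num at hval
    linarith

end RGraph

theorem theorem1p11 (l i j : ℕ) (hj : 1 ≤ j) (hij : j ≤ i) (G : RGraph 3 l)
    (hG : G.LeftCompressed)
    (hm : G.edges.card = (l - 1).choose 3 + (l - 2).choose 2)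
    (hfirst : IsFirstColex (j + 1) G.compl.edges
      ((Finset.Icc (l - 2 - j) (l - 3)).image (fun a => {a, l - 2, l - 1}) ∪
        {{l - 2 - i, l - 2, l}})) :
    G.lagrangian < (RGraph.complete 3 (l - 1)).lagrangian := by
  have hl : 3 ≤ l := by
    have h := (Finset.mem_powersetCard.1 (G.compl.edges_subset
      (hfirst.1 (Finset.mem_union_right _ (Finset.mem_singleton_self _))))).1
      (Finset.mem_insert_self _ _)
    rw [Finset.mem_Icc] at h
    omega
  obtain ⟨n, rfl⟩ := Nat.exists_eq_add_of_le' hl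
  obtain ⟨hin, K, hK, hIK, hcard, hw⟩ := RGraph.exists_weight_eq hj hij hG hm hfirst
  exact RGraph.lagrangian_lt_of_weight_eq hj hij hin hK hIK hcard hw
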